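/- Let $(X,d)$ be a metric space. Let $\mathcal P(X)$ be the set of separably supported probability measures on the Borel $\sigma$-algebra of $X$ (i.e. those concentrated on a separable subset), let $$d_W(\mu,\nu)=\inf_K\int_{X\times X} d(x,y)\,\mathrm dK(x,y)\in[0,\infty],$$ where $K$ ranges over the couplings of $\mu,\nu\in\mathcal P(X)$, i.e. the $K\in\mathcal P(X\times X)$ with marginals $\mu$ and $\nu$, and let $\mathcal P_1(X)$ be the set of $\mu\in\mathcal P(X)$ with $d_W(\delta_x,\mu)<\infty$ for some $x\in X$. A contracting barycenter map on $X$ is a map $b:\mathcal P_1(X)\to X$ with $b(\delta_x)=x$ for all $x\in X$ and $d(b(\mu),b(\nu))\le d_W(\mu,\nu)$ for all $\mu,\nu\in\mathcal P_1(X)$. A conical (geodesic) bicombing on $X$ is a map $\sigma:X\times X\times[0,1]\to X$ such that for all $x,y,x',y'\in X$ and $s,t\in[0,1]$: $\sigma(x,y,0)=x$, $\sigma(x,y,1)=y$, $d(\sigma(x,y,s),\sigma(x,y,t))=|s-t|\,d(x,y)$, and $$d(\sigma(x,y,t),\sigma(x',y',t))\le(1-t)\,d(x,x')+t\,d(y,y').$$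 1. If $b$ is a contracting barycenter map on $X$, then $\sigma(x,y,t):=b((1-t)\delta_x+t\delta_y)$ is a conical bicombing on $X$. In particular, if $X$ admits a contracting barycenter map, it admits a conical bicombing. 2. If $X$ is complete and admits a conical bicombing, then $X$ admits a contracting barycenter map. -/

import Mathlib

open MeasureTheory
open scoped ENNReal

noncomputable section

/-- The set `𝒫(Z)` of separably supported probability measures on the Borel `σ`-algebra of `Z`.
The measure is concentrated on a separable set (equivalently, passing to the closure when `Z` is
metrizable, on a closed separable set). The Borel `σ`-algebra is used explicitly,
because on a product `X × X` it can be larger than the product `σ`-algebra. -/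
structure SepProb (Z : Type*) [TopologicalSpace Z] where
  meas : @Measure Z (borel Z)
  prob : IsProbabilityMeasure meas
  sep : ∃ S : Set Z, TopologicalSpace.IsSeparable S ∧ meas Sᶜ = 0

/-- The Dirac measure at `x` on the Borel `σ`-algebra. -/
def borelDirac {Z : Type*} [TopologicalSpace Z] (x : Z) : @Measure Z (borel Z) :=
  @Measure.dirac Z (borel Z) x

/-- The measure `(1 - t) δ_x + t δ_y` as an element of `𝒫(Z)`. -/
def SepProb.mix {Z : Type*} [TopologicalSpace Z] (x y : Z) (t : unitInterval) : SepProb Z where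
  meas := ENNReal.ofReal (1 - (t : ℝ)) • borelDirac x + ENNReal.ofReal (t : ℝ) • borelDirac y
  prob := by
    let : MeasurableSpace Z := borel Z
    refine ⟨?_⟩
    simp only [borelDirac, Measure.add_apply, Measure.smul_apply, Measure.dirac_apply_of_mem,
      Set.mem_univ, smul_eq_mul, mul_one]
    rw [← ENNReal.ofReal_add (sub_nonneg.2 t.2.2) t.2.1]
    simp
  sep := by
    let : MeasurableSpace Z := borel Z
    refine ⟨closure {x, y}, (Set.toFinite {x, y}).countable.isSeparable.closure, ?_⟩
    have hm : MeasurableSet (closure ({x, y} : Set Z))ᶜ :=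
      MeasurableSpace.measurableSet_generateFrom isClosed_closure.isOpen_compl
    have hx : x ∈ closure ({x, y} : Set Z) := subset_closure (by simp)
    have hy : y ∈ closure ({x, y} : Set Z) := subset_closure (by simp)
    simp [borelDirac, Measure.dirac_apply' _ hm, hx, hy]

/-- The Dirac measure `δ_x` as an element of `𝒫(Z)`. -/
def SepProb.dirac {Z : Type*} [TopologicalSpace Z] (x : Z) : SepProb Z where
  meas := borelDirac x
  prob := by
    let : MeasurableSpace Z := borel Z
    exact Measure.dirac.isProbabilityMeasure
  sep := by
    let : MeasurableSpace Z := borel Z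
    refine ⟨closure {x}, (Set.countable_singleton x).isSeparable.closure, ?_⟩
    have hm : MeasurableSet (closure ({x} : Set Z))ᶜ :=
      MeasurableSpace.measurableSet_generateFrom isClosed_closure.isOpen_compl
    have hx : x ∈ closure ({x} : Set Z) := subset_closure (by simp)
    simp [borelDirac, Measure.dirac_apply' _ hm, hx]

/-- `K ∈ 𝒫(X × X)` is a coupling of `μ` and `ν`: its marginals are `μ` and `ν`. -/
def IsCoupling {X : Type*} [TopologicalSpace X] (μ ν : SepProb X) (K : SepProb (X × X)) : Prop :=
  @Measure.map (X × X) X (borel (X × X)) (borel X) Prod.fst K.meas = μ.meas ∧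
  @Measure.map (X × X) X (borel (X × X)) (borel X) Prod.snd K.meas = ν.meas

/-- The Wasserstein `1`-distance on `𝒫(X)`, with values in `[0, ∞]`. -/
def wassersteinDist {X : Type*} [MetricSpace X] (μ ν : SepProb X) : ℝ≥0∞ :=
  ⨅ (K : SepProb (X × X)) (_ : IsCoupling μ ν K), ∫⁻ p, edist p.1 p.2 ∂K.meas

/-- Wasserstein `1`-space `𝒫₁(X)`: the measures in `𝒫(X)` at finite Wasserstein distance from
some Dirac measure. -/
def Wasserstein1 (X : Type*) [MetricSpace X] : Type _ :=
  {μ : SepProb X // ∃ x : X, wassersteinDist (SepProb.dirac x) μ < ∞}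

lemma wassersteinDist_dirac_mix_lt_top {X : Type*} [MetricSpace X] (x y : X) (t : unitInterval) :
    wassersteinDist (SepProb.dirac x) (SepProb.mix x y t) < ∞ := by
  let : MeasurableSpace X := borel X
  have : BorelSpace X := ⟨rfl⟩
  let : MeasurableSpace (X × X) := borel (X × X)
  have : BorelSpace (X × X) := ⟨rfl⟩
  have h1 : Measurable (Prod.fst : X × X → X) := continuous_fst.measurable
  have h2 : Measurable (Prod.snd : X × X → X) := continuous_snd.measurable
  have hd : Measurable fun p : X × X => edist p.1 p.2 := continuous_edist.measurable
  have hK : IsCoupling (SepProb.dirac x) (SepProb.mix x y t) (SepProb.mix (x, x) (x, y) t) := by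
    constructor
    · change Measure.map Prod.fst (_ • Measure.dirac (x, x) + _ • Measure.dirac (x, y)) =
        Measure.dirac x
      rw [Measure.map_add _ _ h1, Measure.map_smul, Measure.map_smul, Measure.map_dirac' h1,
        Measure.map_dirac' h1, ← add_smul, ← ENNReal.ofReal_add (sub_nonneg.2 t.2.2) t.2.1]
      simp
    · change Measure.map Prod.snd (_ • Measure.dirac (x, x) + _ • Measure.dirac (x, y)) =
        _ • Measure.dirac x + _ • Measure.dirac y
      rw [Measure.map_add _ _ h2, Measure.map_smul, Measure.map_smul, Measure.map_dirac' h2,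
        Measure.map_dirac' h2]
  refine (iInf₂_le _ hK).trans_lt ?_
  change ∫⁻ p : X × X, edist p.1 p.2 ∂(ENNReal.ofReal (1 - (t : ℝ)) • Measure.dirac (x, x) +
    ENNReal.ofReal (t : ℝ) • Measure.dirac (x, y)) < ∞
  rw [lintegral_add_measure, lintegral_smul_measure, lintegral_smul_measure,
    lintegral_dirac' _ hd, lintegral_dirac' _ hd]
  simpa using ENNReal.mul_lt_top ENNReal.ofReal_lt_top (edist_lt_top x y)

lemma SepProb.mix_zero {X : Type*} [TopologicalSpace X] (x y : X) :
    SepProb.mix x y 0 = SepProb.dirac x := by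
  simp [SepProb.mix, SepProb.dirac]

/-- The measure `(1 - t) δ_x + t δ_y` as an element of `𝒫₁(X)`. -/
def Wasserstein1.mix {X : Type*} [MetricSpace X] (x y : X) (t : unitInterval) : Wasserstein1 X :=
  ⟨SepProb.mix x y t, x, wassersteinDist_dirac_mix_lt_top x y t⟩

/-- The Dirac measure `δ_x` as an element of `𝒫₁(X)`. -/
def Wasserstein1.dirac {X : Type*} [MetricSpace X] (x : X) : Wasserstein1 X :=
  ⟨SepProb.dirac x, x, by
    simpa [SepProb.mix_zero] using wassersteinDist_dirac_mix_lt_top x x 0⟩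

/-- A contracting barycenter map on `X`: a retraction for `δ : X → 𝒫₁(X)` that is `1`-Lipschitz
for the Wasserstein `1`-distance. -/
structure IsContractingBarycenterMap {X : Type*} [MetricSpace X] (b : Wasserstein1 X → X) :
    Prop where
  map_dirac : ∀ x, b (Wasserstein1.dirac x) = x
  contracting : ∀ μ ν, edist (b μ) (b ν) ≤ wassersteinDist μ.1 ν.1

/-- A conical (geodesic) bicombing on `X`: each `σ x y` is a constant speed shortest path from `x`
to `y` (so that `X` is in particular a geodesic space), and the conical inequality holds. -/
structure IsConicalBicombing {X : Type*} [MetricSpace X] (σ : X → X → unitInterval → X) :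
    Prop where
  map_zero : ∀ x y, σ x y 0 = x
  map_one : ∀ x y, σ x y 1 = y
  geodesic : ∀ x y (s t : unitInterval),
    dist (σ x y s) (σ x y t) = |(s : ℝ) - (t : ℝ)| * dist x y
  conical : ∀ x y x' y' (t : unitInterval),
    dist (σ x y t) (σ x' y' t) ≤ (1 - (t : ℝ)) * dist x x' + (t : ℝ) * dist y y'

end

open Filter Topology ProbabilityTheory

/-!
A contracting barycenter map turns couplings of two-point measures into the inequalities of a
conical bicombing.

Conversely, the midpoints of a conical bicombing give rise to means of `n`-tuples: replacing each
entry of an `(n + 1)`-tuple by the mean of the other `n` entries, over and over, collapses the tuple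
to a point, which is its mean (the construction of Es-Sahib–Heinich and Navas). These means are
symmetric and `1`-Lipschitz for the normalised `ℓ¹`-distance of tuples, and the distance from a
fixed point to the mean of an i.i.d. sample is a reverse submartingale, so its expectation decreases
in the sample size. For finitely supported laws the law of large numbers makes two samples of the
same law agree up to permutation and a negligible number of entries, so sample means concentrate
near a point. By approximation this holds for all laws of finite first moment, and hence their
sample means converge in `L¹` to a point, the barycenter. Evaluating two random variables on a
common sample shows that barycenters are at most the expected distance apart.
-/

/-! ### Symmetric means of tuples -/

/-- A symmetric mean of `ι`-tuples which, with respect to the coordinatewise transport cost, is as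
contracting as a barycenter of uniform measures on `ι` has to be. -/
structure IsSymmMean {X ι : Type*} [MetricSpace X] [Fintype ι] (β : (ι → X) → X) : Prop where
  const : ∀ z, β (fun _ => z) = z
  comp_perm : ∀ (π : Equiv.Perm ι) (x : ι → X), β (x ∘ π) = β x
  card_mul_dist_le : ∀ x y : ι → X, Fintype.card ι * dist (β x) (β y) ≤ ∑ i, dist (x i) (y i)

theorem IsSymmMean.card_mul_dist_const_le {X ι : Type*} [MetricSpace X] [Fintype ι]
    {β : (ι → X) → X} (h : IsSymmMean β) (z : X) (x : ι → X) :
    Fintype.card ι * dist z (β x) ≤ ∑ i, dist z (x i) := by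
  simpa only [h.const] using h.card_mul_dist_le (fun _ => z) x

/-- A self-map of `ι`-tuples whose iterates collapse every tuple to a single point, in a way that
turns the limit point into a symmetric mean. -/
structure IsAveragingStep {X ι : Type*} [MetricSpace X] [Fintype ι]
    (Φ : (ι → X) → ι → X) : Prop where
  comp_perm : ∀ (π : Equiv.Perm ι) (x : ι → X), Φ (x ∘ π) = Φ x ∘ π
  sum_dist_le : ∀ x y : ι → X, ∑ i, dist (Φ x i) (Φ y i) ≤ ∑ i, dist (x i) (y i)
  dist_le_half : ∀ (x : ι → X) (i j : ι), dist (Φ x i) (Φ x j) ≤ dist (x i) (x j) / 2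
  displacement_le : ∀ (x : ι → X) (i : ι), dist (x i) (Φ x i) ≤ ∑ j, dist (x i) (x j)

namespace IsAveragingStep

variable {X ι : Type*} [MetricSpace X] [Fintype ι] {Φ : (ι → X) → ι → X}

theorem const (h : IsAveragingStep Φ) (z : X) : Φ (fun _ => z) = fun _ => z := by
  funext i
  have := h.displacement_le (fun _ => z) i
  simp only [dist_self, Finset.sum_const_zero] at this
  exact (dist_le_zero.1 this).symm

theorem iterate_comp_perm (h : IsAveragingStep Φ) (π : Equiv.Perm ι) (x : ι → X) (k : ℕ) :
    Φ^[k] (x ∘ π) = Φ^[k] x ∘ π :=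
  ((show Function.Semiconj (· ∘ π) Φ Φ from fun y => (h.comp_perm π y).symm).iterate_right k x).symm

theorem sum_dist_iterate_le (h : IsAveragingStep Φ) (x y : ι → X) (k : ℕ) :
    ∑ i, dist (Φ^[k] x i) (Φ^[k] y i) ≤ ∑ i, dist (x i) (y i) := by
  induction k with
  | zero => rfl
  | succ k ih =>
    simp only [Function.iterate_succ_apply']
    exact (h.sum_dist_le _ _).trans ih

theorem dist_iterate_le (h : IsAveragingStep Φ) (x : ι → X) (i j : ι) (k : ℕ) :
    dist (Φ^[k] x i) (Φ^[k] x j) ≤ dist (x i) (x j) / 2 ^ k := by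
  induction k with
  | zero => simp
  | succ k ih =>
    rw [Function.iterate_succ_apply', pow_succ, ← div_div]
    exact (h.dist_le_half _ i j).trans (by gcongr)

theorem cauchySeq_iterate (h : IsAveragingStep Φ) (x : ι → X) (i : ι) :
    CauchySeq fun k => Φ^[k] x i := by
  refine cauchySeq_of_le_geometric_two (C := 2 * ∑ j, dist (x i) (x j)) fun k => ?_
  rw [Function.iterate_succ_apply', mul_div_cancel_left₀ _ two_ne_zero, Finset.sum_div]
  exact (h.displacement_le _ i).trans
    (Finset.sum_le_sum fun j _ => h.dist_iterate_le x i j k)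

theorem exists_tendsto_iterate [CompleteSpace X] [Nonempty ι] (h : IsAveragingStep Φ) (x : ι → X) :
    ∃ z, ∀ i, Tendsto (fun k => Φ^[k] x i) atTop (𝓝 z) := by
  obtain ⟨i₀⟩ := ‹Nonempty ι›
  obtain ⟨z, hz⟩ := cauchySeq_tendsto_of_complete (h.cauchySeq_iterate x i₀)
  refine ⟨z, fun i => hz.congr_dist ?_⟩
  have hbound : Tendsto (fun k : ℕ => dist (x i₀) (x i) / 2 ^ k) atTop (𝓝 0) := by
    simpa only [div_eq_mul_inv, mul_zero, inv_pow] using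
      (tendsto_pow_atTop_nhds_zero_of_lt_one (r := (2 : ℝ)⁻¹) (by norm_num)
        (by norm_num)).const_mul (dist (x i₀) (x i))
  exact squeeze_zero (fun _ => dist_nonneg) (h.dist_iterate_le x i₀ i) hbound

theorem exists_isSymmMean [CompleteSpace X] [Nonempty ι] (h : IsAveragingStep Φ) :
    ∃ β : (ι → X) → X, IsSymmMean β ∧ ∀ x, β (Φ x) = β x := by
  choose β hβ using h.exists_tendsto_iterate
  obtain ⟨i₀⟩ := ‹Nonempty ι›
  refine ⟨β, ⟨fun z => ?_, fun π x => ?_, fun x y => ?_⟩, fun x => ?_⟩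
  · refine tendsto_nhds_unique (hβ _ i₀) ?_
    simp only [Function.iterate_fixed (h.const z), tendsto_const_nhds]
  · refine tendsto_nhds_unique (hβ _ i₀) ?_
    simpa only [h.iterate_comp_perm π x, Function.comp_apply] using hβ x (π i₀)
  · have hlim : Tendsto (fun k => ∑ i, dist (Φ^[k] x i) (Φ^[k] y i)) atTop
        (𝓝 (∑ _ : ι, dist (β x) (β y))) :=
      tendsto_finsetSum _ fun i _ => (hβ x i).dist (hβ y i)
    simpa using le_of_tendsto' hlim (h.sum_dist_iterate_le x y)
  · exact tendsto_nhds_unique (hβ (Φ x) i₀) ((tendsto_add_atTop_iff_nat 1).2 (hβ x i₀))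

end IsAveragingStep

section LeaveOneOut

variable {X : Type*} {n : ℕ}

/-- The values of an `n`-point mean on the `n + 1` subtuples obtained by dropping one entry. -/
def leaveOneOut (β : (Fin n → X) → X) (x : Fin (n + 1) → X) (i : Fin (n + 1)) : X :=
  β (x ∘ i.succAbove)

theorem exists_perm_comp_succAbove (π : Equiv.Perm (Fin (n + 1))) (i : Fin (n + 1)) :
    ∃ e : Equiv.Perm (Fin n), π ∘ i.succAbove = (π i).succAbove ∘ e := by
  have hπ : ∀ j, j ≠ i ↔ π j ≠ π i := fun j => π.injective.ne_iff.symm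
  refine ⟨(finSuccAboveEquiv i).trans
    ((π.subtypeEquiv hπ).trans (finSuccAboveEquiv (π i)).symm), funext fun j => ?_⟩
  have := congrArg Subtype.val ((finSuccAboveEquiv (π i)).apply_symm_apply
    (π.subtypeEquiv hπ (finSuccAboveEquiv i j)))
  exact this.symm

variable [MetricSpace X] {β : (Fin n → X) → X}

namespace IsSymmMean

theorem leaveOneOut_comp_perm (h : IsSymmMean β) (π : Equiv.Perm (Fin (n + 1)))
    (x : Fin (n + 1) → X) : leaveOneOut β (x ∘ π) = leaveOneOut β x ∘ π := by
  funext i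
  obtain ⟨e, he⟩ := exists_perm_comp_succAbove π i
  simp only [leaveOneOut, Function.comp_apply, Function.comp_assoc, he]
  rw [← Function.comp_assoc, h.comp_perm]

theorem mul_sum_dist_leaveOneOut_le (h : IsSymmMean β) (x y : Fin (n + 1) → X) :
    n * ∑ i, dist (leaveOneOut β x i) (leaveOneOut β y i) ≤ n * ∑ i, dist (x i) (y i) :=
  calc n * ∑ i, dist (leaveOneOut β x i) (leaveOneOut β y i)
      = ∑ i, n * dist (leaveOneOut β x i) (leaveOneOut β y i) := Finset.mul_sum _ _ _
    _ ≤ ∑ i, ((∑ j, dist (x j) (y j)) - dist (x i) (y i)) := by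
      refine Finset.sum_le_sum fun i _ => ?_
      rw [Fin.sum_univ_succAbove _ i, add_sub_cancel_left]
      simpa only [Fintype.card_fin, Function.comp_apply, leaveOneOut] using
        h.card_mul_dist_le (x ∘ i.succAbove) (y ∘ i.succAbove)
    _ = n * ∑ i, dist (x i) (y i) := by
      rw [Finset.sum_sub_distrib, Finset.sum_const, Finset.card_fin, nsmul_eq_mul]
      push_cast
      ring

theorem mul_dist_leaveOneOut_le (h : IsSymmMean β) (x : Fin (n + 1) → X) (i j : Fin (n + 1)) :
    n * dist (leaveOneOut β x i) (leaveOneOut β x j) ≤ dist (x i) (x j) := by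
  rcases eq_or_ne i j with rfl | hij
  · simp
  have hswap : leaveOneOut β x j = β ((x ∘ Equiv.swap i j) ∘ i.succAbove) := by
    simpa [leaveOneOut] using (congrFun (h.leaveOneOut_comp_perm (Equiv.swap i j) x) i).symm
  obtain ⟨k, rfl⟩ := Fin.exists_succAbove_eq hij.symm
  have hfixed : ∀ l ≠ k, Equiv.swap i (i.succAbove k) (i.succAbove l) = i.succAbove l := fun l hl =>
    Equiv.swap_apply_of_ne_of_ne (i.succAbove_ne l) (i.succAbove_right_injective.ne hl)
  have hmean := h.card_mul_dist_le (x ∘ i.succAbove)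
    ((x ∘ Equiv.swap i (i.succAbove k)) ∘ i.succAbove)
  rw [Finset.sum_eq_single k (fun l _ hl => by simp [hfixed l hl]) (by simp), ← hswap] at hmean
  simpa [leaveOneOut, dist_comm] using hmean

theorem isAveragingStep_leaveOneOut (h : IsSymmMean β) (hn : 2 ≤ n) :
    IsAveragingStep (leaveOneOut β) where
  comp_perm := h.leaveOneOut_comp_perm
  sum_dist_le x y :=
    le_of_mul_le_mul_left (h.mul_sum_dist_leaveOneOut_le x y) (by positivity)
  dist_le_half x i j := by
    have hn' : (2 : ℝ) ≤ n := by exact_mod_cast hn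
    rw [le_div_iff₀' two_pos]
    exact (mul_le_mul_of_nonneg_right hn' dist_nonneg).trans (h.mul_dist_leaveOneOut_le x i j)
  displacement_le x i := by
    have hn' : (1 : ℝ) ≤ n := by exact_mod_cast one_le_two.trans hn
    have hmean := h.card_mul_dist_const_le (x i) (x ∘ i.succAbove)
    rw [Fintype.card_fin] at hmean
    rw [Fin.sum_univ_succAbove _ i, dist_self, zero_add]
    exact (le_mul_of_one_le_left dist_nonneg hn').trans hmean

theorem exists_succ [CompleteSpace X] (h : IsSymmMean β) (hn : 2 ≤ n) :
    ∃ β' : (Fin (n + 1) → X) → X, IsSymmMean β' ∧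
      ∀ x z, (n + 1 : ℕ) * dist z (β' x) ≤ ∑ i, dist z (leaveOneOut β x i) := by
  obtain ⟨β', hβ', hfix⟩ := (h.isAveragingStep_leaveOneOut hn).exists_isSymmMean
  refine ⟨β', hβ', fun x z => ?_⟩
  simpa [hfix] using hβ'.card_mul_dist_const_le z (leaveOneOut β x)

end IsSymmMean

end LeaveOneOut

/-- A binary operation satisfying the inequality of a conical bicombing at time `1 / 2`. -/
structure IsConicalMidpoint {X : Type*} [MetricSpace X] (m : X → X → X) : Prop where
  self : ∀ x, m x x = x
  conical : ∀ x y x' y', 2 * dist (m x y) (m x' y') ≤ dist x x' + dist y y'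

/-- A sequence of symmetric means, the `n`-th one on `(n + 2)`-tuples, such that each mean is
closer to any given point than the previous one is on average when one entry is dropped. On
independent samples this makes the distance to a point a reverse submartingale. -/
structure IsMeanFamily {X : Type*} [MetricSpace X] (β : ∀ n : ℕ, (Fin (n + 2) → X) → X) :
    Prop where
  isSymmMean : ∀ n, IsSymmMean (β n)
  mul_dist_succ_le : ∀ n x z,
    (n + 3 : ℕ) * dist z (β (n + 1) x) ≤ ∑ i, dist z (leaveOneOut (β n) x i)

namespace IsConicalMidpoint

variable {X : Type*} [MetricSpace X] {m : X → X → X}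

theorem two_mul_dist_left_le (hm : IsConicalMidpoint m) (x y : X) :
    2 * dist x (m x y) ≤ dist x y := by
  simpa [hm.self] using hm.conical x x x y

theorem two_mul_dist_right_le (hm : IsConicalMidpoint m) (x y : X) :
    2 * dist y (m x y) ≤ dist x y := by
  simpa [hm.self, dist_comm] using hm.conical y y x y

theorem two_mul_dist_swap_le (hm : IsConicalMidpoint m) (x y : X) :
    2 * dist (m x y) (m y x) ≤ dist x y := by
  have h := hm.conical x y (m y x) (m y x)
  rw [hm.self] at h
  have hx := hm.two_mul_dist_right_le y x
  have hy := hm.two_mul_dist_left_le y x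
  rw [dist_comm y x] at hx hy
  linarith

theorem isAveragingStep (hm : IsConicalMidpoint m) :
    IsAveragingStep fun (x : Fin 2 → X) i => m (x i) (x i.rev) where
  comp_perm π x := by
    have hrev : ∀ (π : Equiv.Perm (Fin 2)) i, π i.rev = (π i).rev := by decide
    funext i
    simp only [Function.comp_apply, hrev]
  sum_dist_le x y := by
    have h₀ := hm.conical (x 0) (x 1) (y 0) (y 1)
    have h₁ := hm.conical (x 1) (x 0) (y 1) (y 0)
    simp only [Fin.sum_univ_two, Fin.rev_zero, Fin.reduceRev, Fin.reduceLast]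
    linarith
  dist_le_half x i j := by
    rcases eq_or_ne i j with rfl | hij
    · simp
    obtain rfl : j = i.rev := by
      revert i j; decide
    rw [Fin.rev_rev, le_div_iff₀' two_pos]
    exact hm.two_mul_dist_swap_le _ _
  displacement_le x i :=
    calc dist (x i) (m (x i) (x i.rev))
        ≤ 2 * dist (x i) (m (x i) (x i.rev)) := le_mul_of_one_le_left dist_nonneg one_le_two
      _ ≤ dist (x i) (x i.rev) := hm.two_mul_dist_left_le _ _
      _ ≤ ∑ j, dist (x i) (x j) :=
        Finset.single_le_sum (f := fun j => dist (x i) (x j)) (fun _ _ => dist_nonneg)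
          (Finset.mem_univ i.rev)

theorem exists_isMeanFamily [CompleteSpace X] (hm : IsConicalMidpoint m) :
    ∃ β : ∀ n : ℕ, (Fin (n + 2) → X) → X, IsMeanFamily β := by
  obtain ⟨β₀, hβ₀, -⟩ := hm.isAveragingStep.exists_isSymmMean
  choose next hnext hle using fun n (β : {β : (Fin (n + 2) → X) → X // IsSymmMean β}) =>
    β.2.exists_succ (Nat.le_add_left 2 n)
  let β : ∀ n, {β : (Fin (n + 2) → X) → X // IsSymmMean β} :=
    fun n => Nat.rec ⟨β₀, hβ₀⟩ (fun n b => ⟨next n b, hnext n b⟩) n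
  refine ⟨fun n => (β n).1, fun n => (β n).2, fun n => hle n (β n)⟩

end IsConicalMidpoint

section Matching

variable {ι α : Type*}

-- A permutation with the most agreements works: a value violating the claim would allow a swap
-- that creates one more agreement.
theorem exists_perm_fiber_subset [Finite ι] (x y : ι → α) :
    ∃ π : Equiv.Perm ι, ∀ a, (∀ i, x i = a → y (π i) = a) ∨ (∀ i, y (π i) = a → x i = a) := by
  classical
  have := Fintype.ofFinite ι
  obtain ⟨π, hπ⟩ := Finite.exists_max fun π : Equiv.Perm ι => Finset.card {i | x i = y (π i)}
  refine ⟨π, fun a => ?_⟩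
  by_contra! ⟨⟨i, hxi, hyi⟩, ⟨j, hyj, hxj⟩⟩
  refine (hπ ((Equiv.swap i j).trans π)).not_gt (Finset.card_lt_card ?_)
  rw [Finset.ssubset_iff]
  refine ⟨i, by simpa [hxi] using Ne.symm hyi, fun l => ?_⟩
  rw [Finset.mem_insert, Finset.mem_filter_univ, Finset.mem_filter_univ, Equiv.trans_apply]
  rintro (rfl | hl)
  · rw [Equiv.swap_apply_left, hxi, hyj]
  · have hli : l ≠ i := by rintro rfl; exact hyi (hl ▸ hxi)
    have hlj : l ≠ j := by rintro rfl; exact hxj (hl.trans hyj)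
    rwa [Equiv.swap_apply_of_ne_of_ne hli hlj]

variable [Fintype ι]

theorem exists_perm_card_ne_le [DecidableEq α] (x y : ι → α) :
    ∃ π : Equiv.Perm ι, ∀ t : Finset α, (∀ i, x i ∈ t) →
      (Finset.card {i | x i ≠ y (π i)} : ℝ) ≤
        ∑ a ∈ t, |(Finset.card {i | x i = a} : ℝ) - Finset.card {i | y i = a}| := by
  classical
  obtain ⟨π, hπ⟩ := exists_perm_fiber_subset x y
  refine ⟨π, fun t ht => ?_⟩
  rw [Finset.card_eq_sum_card_fiberwise (t := t) fun i _ => ht i, Nat.cast_sum]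
  refine Finset.sum_le_sum fun a _ => ?_
  have hy : Finset.card {i | y (π i) = a} = Finset.card {i | y i = a} :=
    Finset.card_equiv π (by simp)
  rw [Finset.filter_filter, ← hy]
  rcases hπ a with h | h
  · rw [Finset.filter_false_of_mem fun i _ hi => hi.1 (hi.2.trans (h i hi.2).symm)]
    simp
  · have hsub : ({i | y (π i) = a} : Finset ι) ⊆ ({i | x i = a} : Finset ι) :=
      Finset.monotone_filter_right _ fun i _ => h i
    rw [← Nat.cast_sub (Finset.card_le_card hsub), Nat.abs_cast, ← Finset.card_sdiff_of_subset hsub]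
    gcongr
    intro i hi
    obtain ⟨hne, rfl⟩ := (Finset.mem_filter_univ i).1 hi
    simpa using hne.symm

theorem IsSymmMean.card_mul_dist_le_diam_mul {X : Type*} [MetricSpace X] [DecidableEq X]
    {β : (ι → X) → X} (h : IsSymmMean β) {t : Finset X} {x y : ι → X} (hx : ∀ i, x i ∈ t)
    (hy : ∀ i, y i ∈ t) :
    Fintype.card ι * dist (β x) (β y) ≤ Metric.diam (t : Set X) *
      ∑ a ∈ t, |(Finset.card {i | x i = a} : ℝ) - Finset.card {i | y i = a}| := by
  obtain ⟨π, hπ⟩ := exists_perm_card_ne_le x y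
  calc Fintype.card ι * dist (β x) (β y)
      ≤ ∑ i, dist (x i) (y (π i)) := by simpa [h.comp_perm] using h.card_mul_dist_le x (y ∘ π)
    _ ≤ ∑ i, if x i ≠ y (π i) then Metric.diam (t : Set X) else 0 := by
      refine Finset.sum_le_sum fun i _ => ?_
      split_ifs with hi
      · exact Metric.dist_le_diam_of_mem t.finite_toSet.isBounded (hx i) (hy _)
      · rw [not_not.1 hi, dist_self]
    _ = Metric.diam (t : Set X) * Finset.card {i | x i ≠ y (π i)} := by
      rw [← Finset.sum_filter, Finset.sum_const, nsmul_eq_mul, mul_comm]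
    _ ≤ _ := mul_le_mul_of_nonneg_left (hπ t hx) Metric.diam_nonneg

end Matching

/-! ### Means of random samples -/

section Expectation

variable {Ω : Type*} [MeasurableSpace Ω] {P : Measure Ω} [IsProbabilityMeasure P]

theorem lintegral_enorm_sub_integral_le {f : Ω → ℝ} (hf : MemLp f 2 P) :
    ∫⁻ ω, ‖f ω - P[f]‖ₑ ∂P ≤ ENNReal.ofReal √Var[f; P] := by
  have hsub : MemLp (fun ω => f ω - P[f]) 2 P := hf.sub (memLp_const _)
  have hvar : eLpNorm (fun ω => f ω - P[f]) 2 P = ENNReal.ofReal √Var[f; P] := by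
    rw [Real.sqrt_eq_rpow, ← ENNReal.ofReal_rpow_of_nonneg (variance_nonneg _ _) (by norm_num),
      hf.ofReal_variance_eq, eLpNorm_eq_lintegral_rpow_enorm_toReal two_ne_zero (by simp),
      evariance]
    simp
  rw [← eLpNorm_one_eq_lintegral_enorm, ← hvar]
  exact eLpNorm_le_eLpNorm_of_exponent_le one_le_two hsub.1

theorem lintegral_enorm_sum_sub_le {ι : Type*} [Fintype ι] {φ : Ω → ℝ} (hφ : Measurable φ)
    (h01 : ∀ ω, φ ω ∈ Set.Icc (0 : ℝ) 1) :
    ∫⁻ ω, ‖∑ i, φ (ω i) - Fintype.card ι * P[φ]‖ₑ ∂Measure.pi (fun _ : ι => P) ≤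
      ENNReal.ofReal √(Fintype.card ι) := by
  have hmem : MemLp φ 2 P := memLp_of_bounded (ae_of_all _ h01) hφ.aestronglyMeasurable 2
  have hmem_eval (i : ι) : MemLp (fun ω => φ (ω i)) 2 (Measure.pi fun _ : ι => P) :=
    hmem.comp_measurePreserving (measurePreserving_eval _ i)
  have hmean : ∫ ω, ∑ i, φ (ω i) ∂Measure.pi (fun _ : ι => P) = Fintype.card ι * P[φ] := by
    rw [integral_finsetSum _ fun i _ => (hmem_eval i).integrable one_le_two]
    simp [fun i => integral_comp_eval (μ := fun _ : ι => P) (i := i) hφ.aestronglyMeasurable]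
  have hvar : Var[fun ω => ∑ i, φ (ω i); Measure.pi fun _ : ι => P] ≤ Fintype.card ι := by
    have h := variance_sum_pi (μ := fun _ : ι => P) fun _ => hmem
    simp only [Finset.sum_fn, Finset.sum_const, Finset.card_univ, nsmul_eq_mul] at h
    rw [h]
    refine mul_le_of_le_one_right (Nat.cast_nonneg _) ?_
    exact (variance_le_sq_of_bounded (ae_of_all _ h01) hφ.aemeasurable).trans (by norm_num)
  rw [← hmean]
  exact (lintegral_enorm_sub_integral_le (memLp_finsetSum _ fun i _ => hmem_eval i)).trans
    (ENNReal.ofReal_le_ofReal (Real.sqrt_le_sqrt hvar))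

end Expectation

section Sampling

variable {Ω ι X Y : Type*} [MeasurableSpace Ω] [TopologicalSpace Y]

theorem stronglyMeasurable_comp_simpleFunc_comp [Finite ι] (g : SimpleFunc Ω X)
    (β : (ι → X) → Y) : StronglyMeasurable fun ω : ι → Ω => β (g ∘ ω) := by
  let gr : Ω → g.range := fun ω => ⟨g ω, g.mem_range_self ω⟩
  let : MeasurableSpace g.range := ⊤
  have hgr : Measurable gr := by
    refine measurable_to_countable' fun a => ?_
    convert g.measurableSet_fiber a using 1
    ext ω
    simp [gr, Subtype.ext_iff]
  have hβ : StronglyMeasurable fun a : ι → g.range => β fun i => a i := .of_discrete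
  exact hβ.comp_measurable (measurable_pi_lambda _ fun i => hgr.comp (measurable_pi_apply i))

theorem aestronglyMeasurable_comp_comp [Fintype ι] [TopologicalSpace X]
    [TopologicalSpace.PseudoMetrizableSpace Y] {P : Measure Ω} [SigmaFinite P] {ξ : Ω → X}
    (hξ : AEStronglyMeasurable ξ P) {β : (ι → X) → Y} (hβ : Continuous β) :
    AEStronglyMeasurable (fun ω : ι → Ω => β (ξ ∘ ω)) (Measure.pi fun _ => P) := by
  obtain ⟨ξ', hξ', hae⟩ := hξ
  refine ⟨fun ω => β (ξ' ∘ ω), ?_, ?_⟩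
  · refine stronglyMeasurable_of_tendsto atTop
      (fun n => stronglyMeasurable_comp_simpleFunc_comp (hξ'.approx n) β) ?_
    refine tendsto_pi_nhds.2 fun ω => (hβ.tendsto _).comp (tendsto_pi_nhds.2 fun i => ?_)
    exact hξ'.tendsto_approx (ω i)
  · filter_upwards [Measure.ae_eq_pi fun _ => hae] with ω hω
    exact congrArg β hω

end Sampling

theorem natCast_mul_edist_le {ι X : Type*} [Fintype ι] [PseudoMetricSpace X] {n : ℕ}
    {x y : X} {a b : ι → X} (h : n * dist x y ≤ ∑ i, dist (a i) (b i)) :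
    n * edist x y ≤ ∑ i, edist (a i) (b i) := by
  simp only [edist_dist]
  rw [← ENNReal.ofReal_natCast, ← ENNReal.ofReal_mul (Nat.cast_nonneg n),
    ← ENNReal.ofReal_sum_of_nonneg fun _ _ => dist_nonneg]
  exact ENNReal.ofReal_le_ofReal h

theorem IsSymmMean.continuous {ι X : Type*} [Fintype ι] [Nonempty ι] [MetricSpace X]
    {β : (ι → X) → X} (h : IsSymmMean β) : Continuous β := by
  refine (LipschitzWith.of_edist_le fun x y => ?_).continuous
  have hcard : (Fintype.card ι : ℝ≥0∞) ≠ 0 := by simp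
  refine (ENNReal.mul_le_mul_iff_right hcard (ENNReal.natCast_ne_top _)).1 ?_
  calc Fintype.card ι * edist (β x) (β y)
      ≤ ∑ i, edist (x i) (y i) := natCast_mul_edist_le (h.card_mul_dist_le x y)
    _ ≤ ∑ _ : ι, edist x y := Finset.sum_le_sum fun i _ => edist_le_pi_edist x y i
    _ = Fintype.card ι * edist x y := by simp

theorem lintegral_comp_measurePreserving {Ω Ω' : Type*} [MeasurableSpace Ω] [MeasurableSpace Ω']
    {P : Measure Ω} {Q : Measure Ω'} {T : Ω' → Ω} (hT : MeasurePreserving T Q P) {F : Ω → ℝ≥0∞}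
    (hF : AEMeasurable F P) : ∫⁻ ω, F (T ω) ∂Q = ∫⁻ ω, F ω ∂P := by
  rw [← hT.map_eq] at hF ⊢
  exact (lintegral_map' hF hT.aemeasurable).symm

/-- The expected distance from `z` to the mean `β` of a sample of the law of `ξ` under `P`. -/
noncomputable def sampleEDist {Ω ι X : Type*} [MeasurableSpace Ω] [Fintype ι] [MetricSpace X]
    (β : (ι → X) → X) (P : Measure Ω) (ξ : Ω → X) (z : X) : ℝ≥0∞ :=
  ∫⁻ ω : ι → Ω, edist z (β (ξ ∘ ω)) ∂Measure.pi fun _ => P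

section SampleMean

variable {Ω ι X : Type*} [MeasurableSpace Ω] {P : Measure Ω} [IsProbabilityMeasure P]
  [Fintype ι] [MetricSpace X] {β : (ι → X) → X} {ξ η : Ω → X}

theorem aemeasurable_edist_comp (hβ : Continuous β) (hξ : AEStronglyMeasurable ξ P) (z : X) :
    AEMeasurable (fun ω : ι → Ω => edist z (β (ξ ∘ ω))) (Measure.pi fun _ => P) :=
  aestronglyMeasurable_const.edist (aestronglyMeasurable_comp_comp hξ hβ)

theorem sampleEDist_le_edist_add (y z : X) :
    sampleEDist β P ξ z ≤ edist z y + sampleEDist β P ξ y :=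
  calc sampleEDist β P ξ z
      ≤ ∫⁻ ω : ι → Ω, edist z y + edist y (β (ξ ∘ ω)) ∂Measure.pi fun _ => P :=
        lintegral_mono fun _ => edist_triangle _ _ _
    _ = edist z y + sampleEDist β P ξ y := by
        rw [lintegral_add_left measurable_const, lintegral_const, measure_univ, mul_one,
          sampleEDist]

theorem sampleEDist_comp_measurePreserving {Ω' : Type*} [MeasurableSpace Ω'] {Q : Measure Ω'}
    {T : Ω' → Ω} (hT : MeasurePreserving T Q P) (hβ : Continuous β)
    (hξ : AEStronglyMeasurable ξ P) (z : X) :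
    sampleEDist β Q (ξ ∘ T) z = sampleEDist β P ξ z :=
  lintegral_comp_measurePreserving
    (measurePreserving_pi (fun _ : ι => Q) (fun _ => P) fun _ => hT)
    (aemeasurable_edist_comp hβ hξ z)

namespace IsSymmMean

theorem sampleEDist_const [Nonempty ι] (h : IsSymmMean β) (x z : X) :
    sampleEDist β P (fun _ => x) z = edist z x := by
  have hx (ω : ι → Ω) : β ((fun _ => x) ∘ ω) = x := h.const x
  simp [sampleEDist, hx]

theorem lintegral_edist_comp_le [Nonempty ι] (h : IsSymmMean β) (hξ : AEStronglyMeasurable ξ P)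
    (hη : AEStronglyMeasurable η P) :
    ∫⁻ ω : ι → Ω, edist (β (ξ ∘ ω)) (β (η ∘ ω)) ∂Measure.pi (fun _ => P) ≤
      ∫⁻ ω, edist (ξ ω) (η ω) ∂P := by
  have hcard : (Fintype.card ι : ℝ≥0∞) ≠ 0 := by simp
  have hcard' : (Fintype.card ι : ℝ≥0∞) ≠ ∞ := ENNReal.natCast_ne_top _
  have hedist : AEMeasurable (fun ω => edist (ξ ω) (η ω)) P := hξ.edist hη
  refine (ENNReal.mul_le_mul_iff_right hcard hcard').1 ?_
  calc Fintype.card ι * ∫⁻ ω : ι → Ω, edist (β (ξ ∘ ω)) (β (η ∘ ω)) ∂Measure.pi (fun _ => P)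
      = ∫⁻ ω : ι → Ω, Fintype.card ι * edist (β (ξ ∘ ω)) (β (η ∘ ω)) ∂Measure.pi (fun _ => P) :=
        (lintegral_const_mul' _ _ hcard').symm
    _ ≤ ∫⁻ ω : ι → Ω, ∑ i, edist (ξ (ω i)) (η (ω i)) ∂Measure.pi (fun _ => P) :=
        lintegral_mono fun ω => natCast_mul_edist_le (h.card_mul_dist_le _ _)
    _ = ∑ i : ι, ∫⁻ ω : ι → Ω, edist (ξ (ω i)) (η (ω i)) ∂Measure.pi (fun _ => P) :=
        lintegral_finsetSum' _ fun i _ =>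
          hedist.comp_quasiMeasurePreserving (measurePreserving_eval _ i).quasiMeasurePreserving
    _ = ∑ _ : ι, ∫⁻ ω, edist (ξ ω) (η ω) ∂P :=
        Finset.sum_congr rfl fun i _ =>
          lintegral_comp_measurePreserving (measurePreserving_eval (fun _ : ι => P) i) hedist
    _ = Fintype.card ι * ∫⁻ ω, edist (ξ ω) (η ω) ∂P := by simp

theorem sampleEDist_le_add [Nonempty ι] (h : IsSymmMean β) (hξ : AEStronglyMeasurable ξ P)
    (hη : AEStronglyMeasurable η P) (z : X) :
    sampleEDist β P η z ≤ sampleEDist β P ξ z + ∫⁻ ω, edist (ξ ω) (η ω) ∂P :=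
  calc sampleEDist β P η z
      ≤ ∫⁻ ω : ι → Ω, edist z (β (ξ ∘ ω)) + edist (β (ξ ∘ ω)) (β (η ∘ ω)) ∂Measure.pi fun _ => P :=
        lintegral_mono fun _ => edist_triangle _ _ _
    _ = sampleEDist β P ξ z +
          ∫⁻ ω : ι → Ω, edist (β (ξ ∘ ω)) (β (η ∘ ω)) ∂Measure.pi fun _ => P :=
        lintegral_add_left' (aemeasurable_edist_comp h.continuous hξ z) _
    _ ≤ sampleEDist β P ξ z + ∫⁻ ω, edist (ξ ω) (η ω) ∂P := by
        gcongr
        exact h.lintegral_edist_comp_le hξ hη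

theorem edist_le_sampleEDist_add [Nonempty ι] (h : IsSymmMean β) (hξ : AEStronglyMeasurable ξ P)
    (y z : X) : edist y z ≤ sampleEDist β P ξ y + sampleEDist β P ξ z :=
  calc edist y z
      = ∫⁻ _ : ι → Ω, edist y z ∂Measure.pi fun _ => P := by simp
    _ ≤ ∫⁻ ω : ι → Ω, edist y (β (ξ ∘ ω)) + edist z (β (ξ ∘ ω)) ∂Measure.pi fun _ => P :=
        lintegral_mono fun _ => edist_triangle_right _ _ _
    _ = sampleEDist β P ξ y + sampleEDist β P ξ z :=
        lintegral_add_left' (aemeasurable_edist_comp h.continuous hξ y) _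

end IsSymmMean

end SampleMean

section Concentration

variable {Ω ι X : Type*} [MeasurableSpace Ω] {P : Measure Ω} [Fintype ι]

open Classical in
/-- The total deviation, over all values of the simple function `g`, between the number of
occurrences of the value in a sample and its expectation. -/
noncomputable def sampleDeviation (P : Measure Ω) (g : SimpleFunc Ω X) (ω : ι → Ω) : ℝ≥0∞ :=
  ∑ a ∈ g.range,
    ‖(Finset.card {i | g (ω i) = a} : ℝ) - Fintype.card ι * P.real (g ⁻¹' {a})‖ₑ

theorem sampleDeviation_eq_sum_indicator (g : SimpleFunc Ω X) (ω : ι → Ω) :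
    sampleDeviation P g ω = ∑ a ∈ g.range, ‖∑ i, (g ⁻¹' {a}).indicator (1 : Ω → ℝ) (ω i) -
      Fintype.card ι * P.real (g ⁻¹' {a})‖ₑ := by
  classical
  simp [sampleDeviation, Set.indicator_apply]

theorem measurable_sampleDeviation (g : SimpleFunc Ω X) :
    Measurable (sampleDeviation P g : (ι → Ω) → ℝ≥0∞) := by
  have hφ (a : X) : Measurable ((g ⁻¹' {a}).indicator (1 : Ω → ℝ)) :=
    measurable_one.indicator (g.measurableSet_fiber a)
  simp only [funext (sampleDeviation_eq_sum_indicator g)]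
  fun_prop

theorem lintegral_sampleDeviation_le [IsProbabilityMeasure P] (g : SimpleFunc Ω X) :
    ∫⁻ ω : ι → Ω, sampleDeviation P g ω ∂Measure.pi (fun _ => P) ≤
      g.range.card * ENNReal.ofReal √(Fintype.card ι) := by
  have hφ (a : X) : Measurable ((g ⁻¹' {a}).indicator (1 : Ω → ℝ)) :=
    measurable_one.indicator (g.measurableSet_fiber a)
  simp only [sampleDeviation_eq_sum_indicator g]
  rw [lintegral_finsetSum _ fun a _ => by fun_prop, ← nsmul_eq_mul]
  refine Finset.sum_le_card_nsmul _ _ _ fun a _ => ?_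
  have h := lintegral_enorm_sum_sub_le (P := P) (ι := ι) (hφ a)
    fun ω => ⟨Set.indicator_nonneg (by simp) ω, Set.indicator_le_self' (by simp) ω⟩
  rwa [integral_indicator_one (g.measurableSet_fiber a)] at h

variable [MetricSpace X] {β : (ι → X) → X}

theorem IsSymmMean.card_mul_edist_le_sampleDeviation (h : IsSymmMean β)
    (g : SimpleFunc Ω X) (ω ω' : ι → Ω) :
    Fintype.card ι * edist (β (g ∘ ω)) (β (g ∘ ω')) ≤
      ENNReal.ofReal (Metric.diam (g.range : Set X)) *
        (sampleDeviation P g ω + sampleDeviation P g ω') := by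
  classical
  have hdist := h.card_mul_dist_le_diam_mul (t := g.range) (x := g ∘ ω) (y := g ∘ ω')
    (fun _ => g.mem_range_self _) (fun _ => g.mem_range_self _)
  rw [edist_dist, ← ENNReal.ofReal_natCast, ← ENNReal.ofReal_mul (Nat.cast_nonneg _)]
  refine (ENNReal.ofReal_le_ofReal hdist).trans ?_
  rw [ENNReal.ofReal_mul Metric.diam_nonneg, ENNReal.ofReal_sum_of_nonneg fun _ _ => abs_nonneg _,
    sampleDeviation, sampleDeviation, ← Finset.sum_add_distrib]
  gcongr with a
  rw [← Real.enorm_eq_ofReal_abs, ← edist_eq_enorm_sub, ← edist_eq_enorm_sub,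
    ← edist_eq_enorm_sub]
  exact edist_triangle_right _ _ _

theorem IsSymmMean.exists_card_mul_sampleEDist_le [IsProbabilityMeasure P]
    (h : IsSymmMean β) (g : SimpleFunc Ω X) :
    ∃ z, Fintype.card ι * sampleEDist β P g z ≤
      ENNReal.ofReal (Metric.diam (g.range : Set X)) *
        (2 * (g.range.card * ENNReal.ofReal √(Fintype.card ι))) := by
  obtain ⟨ω₀, hω₀⟩ := exists_le_lintegral (μ := Measure.pi fun _ : ι => P)
    (measurable_sampleDeviation (P := P) g).aemeasurable
  refine ⟨β (g ∘ ω₀), ?_⟩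
  rw [sampleEDist, ← lintegral_const_mul' _ _ (ENNReal.natCast_ne_top _)]
  refine (lintegral_mono fun ω => h.card_mul_edist_le_sampleDeviation (P := P) g ω₀ ω).trans ?_
  rw [lintegral_const_mul' _ _ ENNReal.ofReal_ne_top, lintegral_add_left measurable_const,
    lintegral_const, measure_univ, mul_one, two_mul]
  gcongr
  · exact hω₀.trans (lintegral_sampleDeviation_le g)
  · exact lintegral_sampleDeviation_le g

end Concentration

theorem measurePreserving_comp_succAbove {Ω : Type*} [MeasurableSpace Ω] (P : Measure Ω)
    [IsProbabilityMeasure P] {n : ℕ} (i : Fin (n + 1)) :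
    MeasurePreserving (fun ω : Fin (n + 1) → Ω => ω ∘ i.succAbove) (Measure.pi fun _ => P)
      (Measure.pi fun _ => P) :=
  measurePreserving_snd.comp (measurePreserving_piFinSuccAbove (fun _ => P) i)

theorem exists_simpleFunc_lintegral_edist_le {Ω X : Type*} [MeasurableSpace Ω] [MetricSpace X]
    {P : Measure Ω} {ξ : Ω → X} (hξ : AEStronglyMeasurable ξ P) {x₀ : X}
    (hx₀ : ∫⁻ ω, edist x₀ (ξ ω) ∂P ≠ ∞) {ε : ℝ≥0∞} (hε : ε ≠ 0) :
    ∃ g : SimpleFunc Ω X, ∫⁻ ω, edist (g ω) (ξ ω) ∂P ≤ ε := by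
  obtain ⟨ξ', hξ', hae⟩ := hξ
  rw [lintegral_congr_ae (hae.mono fun ω hω => congrArg (edist x₀) hω)] at hx₀
  let : MeasurableSpace X := borel X
  have : BorelSpace X := ⟨rfl⟩
  have hsep : TopologicalSpace.IsSeparable (insert x₀ (Set.range ξ')) := by
    rw [Set.insert_eq]
    exact (Set.countable_singleton x₀).isSeparable.union hξ'.isSeparable_range
  have := hsep.separableSpace
  have h₀ : x₀ ∈ insert x₀ (Set.range ξ') := Set.mem_insert _ _
  let g := SimpleFunc.approxOn ξ' hξ'.measurable _ x₀ h₀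
  have hg (n : ℕ) : AEMeasurable (fun ω => edist (g n ω) (ξ' ω)) P :=
    (g n).stronglyMeasurable.aestronglyMeasurable.edist hξ'.aestronglyMeasurable
  have hlim : Tendsto (fun n => ∫⁻ ω, edist (g n ω) (ξ' ω) ∂P) atTop (𝓝 (∫⁻ _, 0 ∂P)) := by
    refine tendsto_lintegral_of_dominated_convergence' _ hg
      (fun n => ae_of_all _ fun ω => SimpleFunc.edist_approxOn_le hξ'.measurable h₀ ω n) hx₀
      (ae_of_all _ fun ω => ?_)
    have hω := SimpleFunc.tendsto_approxOn hξ'.measurable h₀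
      (subset_closure (Set.mem_insert_of_mem _ (Set.mem_range_self ω)))
    simpa using hω.edist (tendsto_const_nhds (x := ξ' ω))
  rw [lintegral_zero] at hlim
  obtain ⟨n, hn⟩ := (hlim.eventually (gt_mem_nhds (pos_iff_ne_zero.2 hε))).exists
  refine ⟨g n, (lintegral_congr_ae (hae.mono fun ω hω => ?_)).trans_le hn.le⟩
  exact congrArg (edist (g n ω)) hω

/-- `y` is the barycenter of the law of `ξ` with respect to the means `β`: the sample means
converge to `y` in `L¹`. -/
def IsBarycenter {Ω X : Type*} [MeasurableSpace Ω] [MetricSpace X]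
    (β : ∀ n : ℕ, (Fin (n + 2) → X) → X) (P : Measure Ω) (ξ : Ω → X) (y : X) : Prop :=
  Tendsto (fun n => sampleEDist (β n) P ξ y) atTop (𝓝 0)

namespace IsMeanFamily

variable {Ω X : Type*} [MeasurableSpace Ω] [MetricSpace X] {P : Measure Ω} [IsProbabilityMeasure P]
  {β : ∀ n : ℕ, (Fin (n + 2) → X) → X} {ξ η : Ω → X} {y z : X}

theorem mul_edist_succ_le (h : IsMeanFamily β) (n : ℕ) (x : Fin (n + 3) → X) (z : X) :
    (n + 3 : ℕ) * edist z (β (n + 1) x) ≤ ∑ i, edist z (leaveOneOut (β n) x i) :=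
  natCast_mul_edist_le (h.mul_dist_succ_le n x z)

theorem antitone_sampleEDist (h : IsMeanFamily β) (hξ : AEStronglyMeasurable ξ P) (z : X) :
    Antitone fun n => sampleEDist (β n) P ξ z := by
  refine antitone_nat_of_succ_le fun n => ?_
  have hmeas := aemeasurable_edist_comp (h.isSymmMean n).continuous hξ z
  have hpres (i : Fin (n + 3)) := measurePreserving_comp_succAbove P i
  have hn : ((n + 3 : ℕ) : ℝ≥0∞) ≠ 0 := by simp
  have hn' : ((n + 3 : ℕ) : ℝ≥0∞) ≠ ∞ := ENNReal.natCast_ne_top _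
  refine (ENNReal.mul_le_mul_iff_right hn hn').1 ?_
  calc (n + 3 : ℕ) * sampleEDist (β (n + 1)) P ξ z
      = ∫⁻ ω : Fin (n + 3) → Ω, (n + 3 : ℕ) * edist z (β (n + 1) (ξ ∘ ω)) ∂Measure.pi fun _ => P :=
        (lintegral_const_mul' _ _ hn').symm
    _ ≤ ∫⁻ ω : Fin (n + 3) → Ω, ∑ i, edist z (leaveOneOut (β n) (ξ ∘ ω) i) ∂Measure.pi fun _ => P :=
        lintegral_mono fun _ => h.mul_edist_succ_le n _ z
    _ = ∑ i, ∫⁻ ω : Fin (n + 3) → Ω, edist z (leaveOneOut (β n) (ξ ∘ ω) i) ∂Measure.pi fun _ => P :=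
        lintegral_finsetSum' _ fun i _ =>
          hmeas.comp_quasiMeasurePreserving (hpres i).quasiMeasurePreserving
    _ = ∑ _ : Fin (n + 3), sampleEDist (β n) P ξ z :=
        Finset.sum_congr rfl fun i _ => lintegral_comp_measurePreserving (hpres i) hmeas
    _ = (n + 3 : ℕ) * sampleEDist (β n) P ξ z := by simp

theorem exists_sampleEDist_simpleFunc_le (h : IsMeanFamily β) (g : SimpleFunc Ω X) {ε : ℝ≥0∞}
    (hε : ε ≠ 0) : ∃ n z, sampleEDist (β n) P g z ≤ ε := by
  obtain ⟨C, hC, hle⟩ : ∃ C : ℝ≥0∞, C ≠ ∞ ∧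
      ∀ n, ∃ z, (n + 2 : ℕ) * sampleEDist (β n) P g z ≤ C * ENNReal.ofReal √(n + 2 : ℕ) := by
    refine ⟨ENNReal.ofReal (Metric.diam (g.range : Set X)) * (2 * g.range.card),
      by finiteness, fun n => ?_⟩
    simpa only [Fintype.card_fin, mul_assoc] using
      (h.isSymmMean n).exists_card_mul_sampleEDist_le (P := P) g
  have hlim : Tendsto (fun n : ℕ => C / ENNReal.ofReal √(n + 2 : ℕ)) atTop (𝓝 (C / ∞)) :=
    ENNReal.Tendsto.const_div (ENNReal.tendsto_ofReal_atTop.comp <| Real.tendsto_sqrt_atTop.comp <|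
      tendsto_natCast_atTop_atTop.comp <| tendsto_add_atTop_nat 2) (.inr hC)
  rw [ENNReal.div_top] at hlim
  obtain ⟨n, hn⟩ := (hlim.eventually (gt_mem_nhds (pos_iff_ne_zero.2 hε))).exists
  obtain ⟨z, hz⟩ := hle n
  refine ⟨n, z, le_trans ?_ hn.le⟩
  have hsqrt : ENNReal.ofReal √(n + 2 : ℕ) ≠ 0 := by
    rw [ENNReal.ofReal_ne_zero_iff]
    positivity
  rw [ENNReal.le_div_iff_mul_le (.inl hsqrt) (.inl ENNReal.ofReal_ne_top)]
  refine (ENNReal.mul_le_mul_iff_left hsqrt ENNReal.ofReal_ne_top).1 ?_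
  rwa [mul_assoc, ← ENNReal.ofReal_mul (Real.sqrt_nonneg _),
    Real.mul_self_sqrt (Nat.cast_nonneg _), ENNReal.ofReal_natCast, mul_comm]

theorem exists_sampleEDist_le (h : IsMeanFamily β) (hξ : AEStronglyMeasurable ξ P) {x₀ : X}
    (hx₀ : ∫⁻ ω, edist x₀ (ξ ω) ∂P ≠ ∞) {ε : ℝ≥0∞} (hε : ε ≠ 0) :
    ∃ n z, sampleEDist (β n) P ξ z ≤ ε := by
  have hε' : ε / 2 ≠ 0 := (ENNReal.half_pos hε).ne'
  obtain ⟨g, hg⟩ := exists_simpleFunc_lintegral_edist_le hξ hx₀ hε'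
  obtain ⟨n, z, hz⟩ := h.exists_sampleEDist_simpleFunc_le (P := P) g hε'
  refine ⟨n, z, ?_⟩
  calc sampleEDist (β n) P ξ z
      ≤ sampleEDist (β n) P g z + ∫⁻ ω, edist (g ω) (ξ ω) ∂P :=
        (h.isSymmMean n).sampleEDist_le_add g.stronglyMeasurable.aestronglyMeasurable hξ z
    _ ≤ ε / 2 + ε / 2 := add_le_add hz hg
    _ = ε := ENNReal.add_halves ε

theorem exists_isBarycenter [CompleteSpace X] (h : IsMeanFamily β)
    (hξ : AEStronglyMeasurable ξ P) {x₀ : X} (hx₀ : ∫⁻ ω, edist x₀ (ξ ω) ∂P ≠ ∞) :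
    ∃ y, IsBarycenter β P ξ y := by
  have hinv (k : ℕ) : (k : ℝ≥0∞)⁻¹ ≠ 0 := ENNReal.inv_ne_zero.2 (ENNReal.natCast_ne_top k)
  choose N z hz using fun k : ℕ => h.exists_sampleEDist_le hξ hx₀ (hinv k)
  have hz' {k n : ℕ} (hn : N k ≤ n) : sampleEDist (β n) P ξ (z k) ≤ (k : ℝ≥0∞)⁻¹ :=
    (h.antitone_sampleEDist hξ (z k) hn).trans (hz k)
  have hcauchy : CauchySeq z := by
    refine EMetric.cauchySeq_iff_le_tendsto_0.2
      ⟨fun M => (M : ℝ≥0∞)⁻¹ + (M : ℝ≥0∞)⁻¹, fun k l M hk hl => ?_, ?_⟩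
    · calc edist (z k) (z l) ≤ (k : ℝ≥0∞)⁻¹ + (l : ℝ≥0∞)⁻¹ :=
            ((h.isSymmMean (max (N k) (N l))).edist_le_sampleEDist_add hξ _ _).trans
              (add_le_add (hz' (le_max_left _ _)) (hz' (le_max_right _ _)))
        _ ≤ (M : ℝ≥0∞)⁻¹ + (M : ℝ≥0∞)⁻¹ := by gcongr
    · simpa using ENNReal.tendsto_inv_nat_nhds_zero.add ENNReal.tendsto_inv_nat_nhds_zero
  obtain ⟨y, hy⟩ := cauchySeq_tendsto_of_complete hcauchy
  have hlim : Tendsto (fun k => edist y (z k) + (k : ℝ≥0∞)⁻¹) atTop (𝓝 0) := by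
    simpa using ((tendsto_const_nhds (x := y)).edist hy).add ENNReal.tendsto_inv_nat_nhds_zero
  refine ⟨y, ENNReal.tendsto_atTop_zero.2 fun ε hε => ?_⟩
  obtain ⟨k, hk⟩ := (hlim.eventually (gt_mem_nhds hε)).exists
  refine ⟨N k, fun n hn => (sampleEDist_le_edist_add (z k) y).trans (le_trans ?_ hk.le)⟩
  gcongr
  exact hz' hn

theorem edist_isBarycenter_le (h : IsMeanFamily β) (hξ : AEStronglyMeasurable ξ P)
    (hη : AEStronglyMeasurable η P) (hy : IsBarycenter β P ξ y) (hz : IsBarycenter β P η z) :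
    edist y z ≤ ∫⁻ ω, edist (ξ ω) (η ω) ∂P := by
  have hle (n : ℕ) : edist y z ≤
      sampleEDist (β n) P ξ y + ∫⁻ ω, edist (ξ ω) (η ω) ∂P + sampleEDist (β n) P η z := by
    refine ((h.isSymmMean n).edist_le_sampleEDist_add hη y z).trans ?_
    gcongr
    exact (h.isSymmMean n).sampleEDist_le_add hξ hη y
  simpa using ge_of_tendsto' ((hy.add tendsto_const_nhds).add hz) hle

theorem isBarycenter_const (h : IsMeanFamily β) (x : X) : IsBarycenter β P (fun _ => x) x := by
  simp [IsBarycenter, (h.isSymmMean _).sampleEDist_const]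

theorem isBarycenter_comp (h : IsMeanFamily β) {Ω' : Type*} [MeasurableSpace Ω']
    {Q : Measure Ω'} {T : Ω' → Ω} (hT : MeasurePreserving T Q P) (hξ : AEStronglyMeasurable ξ P)
    (hy : IsBarycenter β P ξ y) : IsBarycenter β Q (ξ ∘ T) y := by
  simpa only [IsBarycenter, sampleEDist_comp_measurePreserving hT (h.isSymmMean _).continuous hξ]
    using hy

end IsMeanFamily

/-! ### Barycenter maps and bicombings -/

section BarycenterMap

variable {X : Type*} [MetricSpace X]

theorem lintegral_edist_le_wassersteinDist (x₀ : X) (μ : SepProb X) :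
    ∫⁻ x, edist x₀ x ∂μ.meas ≤ wassersteinDist (SepProb.dirac x₀) μ := by
  let : MeasurableSpace X := borel X
  have : BorelSpace X := ⟨rfl⟩
  let : MeasurableSpace (X × X) := borel (X × X)
  have : BorelSpace (X × X) := ⟨rfl⟩
  refine le_iInf₂ fun K hK => le_of_eq ?_
  have hfst : ∀ᵐ p ∂K.meas, p.1 = x₀ := by
    refine ae_of_ae_map (p := (· = x₀)) continuous_fst.aemeasurable ?_
    rw [hK.1]
    exact (ae_dirac_iff (measurableSet_singleton x₀)).2 rfl
  rw [← hK.2, lintegral_map measurable_edist_right continuous_snd.measurable]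
  exact lintegral_congr_ae (hfst.mono fun p hp => congrArg (edist · p.2) hp.symm)

theorem IsMeanFamily.exists_contractingBarycenterMap [CompleteSpace X]
    {β : ∀ n : ℕ, (Fin (n + 2) → X) → X} (h : IsMeanFamily β) :
    ∃ b : Wasserstein1 X → X, IsContractingBarycenterMap b := by
  let : MeasurableSpace X := borel X
  have : BorelSpace X := ⟨rfl⟩
  have hid (μ : SepProb X) : AEStronglyMeasurable id μ.meas := by
    obtain ⟨S, hS, hμS⟩ := μ.sep
    exact aestronglyMeasurable_id_of_isSeparable hS hμS
  have hbary (μ : Wasserstein1 X) : ∃ y, IsBarycenter β μ.1.meas id y := by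
    have := μ.1.prob
    obtain ⟨x₀, hx₀⟩ := μ.2
    exact h.exists_isBarycenter (hid μ.1)
      ((lintegral_edist_le_wassersteinDist x₀ μ.1).trans_lt hx₀).ne
  choose b hb using hbary
  refine ⟨b, fun x => ?_, fun μ ν => le_iInf₂ fun K hK => ?_⟩
  · have := (SepProb.dirac x).prob
    have hle := h.edist_isBarycenter_le (hid (SepProb.dirac x)) aestronglyMeasurable_const
      (hb (Wasserstein1.dirac x)) (h.isBarycenter_const x)
    rw [← edist_le_zero]
    refine hle.trans_eq ?_
    exact (lintegral_dirac' x measurable_edist_left).trans (edist_self x)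
  · let : MeasurableSpace (X × X) := borel (X × X)
    have : BorelSpace (X × X) := ⟨rfl⟩
    have := μ.1.prob
    have := ν.1.prob
    have := K.prob
    have hfst : MeasurePreserving Prod.fst K.meas μ.1.meas := ⟨continuous_fst.measurable, hK.1⟩
    have hsnd : MeasurePreserving Prod.snd K.meas ν.1.meas := ⟨continuous_snd.measurable, hK.2⟩
    have hbfst := h.isBarycenter_comp hfst (hid μ.1) (hb μ)
    have hbsnd := h.isBarycenter_comp hsnd (hid ν.1) (hb ν)
    exact h.edist_isBarycenter_le ((hid μ.1).comp_measurePreserving hfst)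
      ((hid ν.1).comp_measurePreserving hsnd) hbfst hbsnd

theorem IsConicalBicombing.isConicalMidpoint {σ : X → X → unitInterval → X}
    (h : IsConicalBicombing σ) :
    IsConicalMidpoint fun x y => σ x y ⟨1 / 2, by norm_num, by norm_num⟩ where
  self x := by
    have hconst := h.geodesic x x ⟨1 / 2, by norm_num, by norm_num⟩ 0
    rw [h.map_zero, dist_self, mul_zero] at hconst
    exact dist_eq_zero.1 hconst
  conical x y x' y' := by
    have hhalf := h.conical x y x' y' ⟨1 / 2, by norm_num, by norm_num⟩
    dsimp only at hhalf
    linarith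

end BarycenterMap

section Bicombing

variable {X : Type*} [MetricSpace X]

theorem wassersteinDist_le_sum {ι : Type*} [Fintype ι] {μ ν : SepProb X} (w : ι → ℝ≥0∞)
    (x y : ι → X) (hμ : μ.meas = ∑ i, w i • borelDirac (x i))
    (hν : ν.meas = ∑ i, w i • borelDirac (y i)) :
    wassersteinDist μ ν ≤ ∑ i, w i * edist (x i) (y i) := by
  let : MeasurableSpace X := borel X
  have : BorelSpace X := ⟨rfl⟩
  let : MeasurableSpace (X × X) := borel (X × X)
  have : BorelSpace (X × X) := ⟨rfl⟩
  let κ : Measure (X × X) := ∑ i, w i • Measure.dirac (x i, y i)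
  have hfst : κ.map Prod.fst = μ.meas := by
    rw [hμ, Measure.map_finset_sum continuous_fst.aemeasurable]
    simp [borelDirac, Measure.map_dirac' continuous_fst.measurable]
  have hsnd : κ.map Prod.snd = ν.meas := by
    rw [hν, Measure.map_finset_sum continuous_snd.aemeasurable]
    simp [borelDirac, Measure.map_dirac' continuous_snd.measurable]
  have hprob : IsProbabilityMeasure κ := by
    have := μ.prob
    rw [← hfst] at this
    exact κ.isProbabilityMeasure_of_map Prod.fst
  have hsep : κ (Set.range fun i => (x i, y i))ᶜ = 0 := by
    simp only [κ, Measure.finsetSum_apply, Measure.smul_apply, smul_eq_mul,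
      Measure.dirac_apply' _ (Set.finite_range _).measurableSet.compl]
    simpa using fun i => Or.inr ⟨i, rfl, rfl⟩
  let K : SepProb (X × X) := ⟨κ, hprob, _, (Set.finite_range _).countable.isSeparable, hsep⟩
  refine (iInf₂_le K ⟨hfst, hsnd⟩).trans_eq ?_
  simp [K, κ]

theorem dist_eq_abs_sub_mul_dist_of_le {γ : unitInterval → X}
    (hγ : ∀ s t, s ≤ t → dist (γ s) (γ t) ≤ ((t : ℝ) - s) * dist (γ 0) (γ 1)) (s t : unitInterval) :
    dist (γ s) (γ t) = |(s : ℝ) - t| * dist (γ 0) (γ 1) := by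
  wlog hst : s ≤ t generalizing s t
  · rw [dist_comm, abs_sub_comm, this t s (le_of_not_ge hst)]
  have hs := hγ 0 s s.2.1
  have ht := hγ t 1 t.2.2
  have htri := dist_triangle4 (γ 0) (γ s) (γ t) (γ 1)
  rw [Set.Icc.coe_zero] at hs
  rw [Set.Icc.coe_one] at ht
  rw [abs_sub_comm, abs_of_nonneg (sub_nonneg.2 (show (s : ℝ) ≤ t from hst))]
  exact (hγ s t hst).antisymm (by linarith)

theorem SepProb.mix_one (x y : X) : SepProb.mix x y 1 = SepProb.dirac y := by
  simp [SepProb.mix, SepProb.dirac]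

theorem wassersteinDist_mix_mix_le (x y x' y' : X) (t : unitInterval) :
    wassersteinDist (SepProb.mix x y t) (SepProb.mix x' y' t) ≤
      ENNReal.ofReal ((1 - t) * dist x x' + t * dist y y') := by
  have hsum := wassersteinDist_le_sum (μ := SepProb.mix x y t) (ν := SepProb.mix x' y' t)
    ![ENNReal.ofReal (1 - t), ENNReal.ofReal t] ![x, y] ![x', y']
    (by simp [SepProb.mix]) (by simp [SepProb.mix])
  have ht₀ := t.2.1
  have ht₁ := sub_nonneg.2 t.2.2
  rw [ENNReal.ofReal_add (by positivity) (by positivity), ENNReal.ofReal_mul ht₀,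
    ENNReal.ofReal_mul ht₁, ← edist_dist, ← edist_dist]
  simpa using hsum

-- The transport plan moves mass `t - s` from `x` to `y`.
theorem wassersteinDist_mix_le_of_le (x y : X) {s t : unitInterval} (hst : s ≤ t) :
    wassersteinDist (SepProb.mix x y s) (SepProb.mix x y t) ≤
      ENNReal.ofReal ((t - s) * dist x y) := by
  have hs₀ := s.2.1
  have ht₁ := sub_nonneg.2 t.2.2
  have hst' : 0 ≤ (t : ℝ) - s := sub_nonneg.2 hst
  have hsum := wassersteinDist_le_sum (μ := SepProb.mix x y s) (ν := SepProb.mix x y t)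
    ![ENNReal.ofReal (1 - t), ENNReal.ofReal (t - s), ENNReal.ofReal s] ![x, x, y] ![x, y, y]
    (by simp [SepProb.mix, Fin.sum_univ_three, ← add_smul, ← ENNReal.ofReal_add ht₁ hst'])
    (by simp [SepProb.mix, Fin.sum_univ_three, add_assoc, ← add_smul,
      ← ENNReal.ofReal_add hst' hs₀])
  rw [ENNReal.ofReal_mul hst', ← edist_dist]
  simpa [Fin.sum_univ_three] using hsum

theorem IsContractingBarycenterMap.dist_le {b : Wasserstein1 X → X}
    (hb : IsContractingBarycenterMap b) {μ ν : Wasserstein1 X} {r : ℝ} (hr : 0 ≤ r)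
    (h : wassersteinDist μ.1 ν.1 ≤ ENNReal.ofReal r) : dist (b μ) (b ν) ≤ r :=
  (edist_le_ofReal hr).1 ((hb.contracting μ ν).trans h)

theorem IsContractingBarycenterMap.isConicalBicombing {b : Wasserstein1 X → X}
    (hb : IsContractingBarycenterMap b) :
    IsConicalBicombing fun x y t => b (Wasserstein1.mix x y t) := by
  have hzero (x y : X) : b (Wasserstein1.mix x y 0) = x :=
    (congrArg b (Subtype.ext (SepProb.mix_zero x y))).trans (hb.map_dirac x)
  have hone (x y : X) : b (Wasserstein1.mix x y 1) = y :=
    (congrArg b (Subtype.ext (SepProb.mix_one x y))).trans (hb.map_dirac y)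
  refine ⟨hzero, hone, fun x y s t => ?_, fun x y x' y' t => ?_⟩
  · have hle (s t : unitInterval) (hst : s ≤ t) :
        dist (b (Wasserstein1.mix x y s)) (b (Wasserstein1.mix x y t)) ≤ (t - s) * dist x y :=
      hb.dist_le (mul_nonneg (sub_nonneg.2 hst) dist_nonneg) (wassersteinDist_mix_le_of_le x y hst)
    simpa only [hzero, hone] using dist_eq_abs_sub_mul_dist_of_le
      (γ := fun t => b (Wasserstein1.mix x y t)) (by simpa only [hzero, hone] using hle) s t
  · have ht₀ := t.2.1
    have ht₁ := sub_nonneg.2 t.2.2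
    exact hb.dist_le (by positivity) (wassersteinDist_mix_mix_le x y x' y' t)

end Bicombing

theorem theorem2p4 {X : Type*} [MetricSpace X] :
    (∀ b : Wasserstein1 X → X, IsContractingBarycenterMap b →
      IsConicalBicombing (fun x y t => b (Wasserstein1.mix x y t))) ∧
    (CompleteSpace X → (∃ σ : X → X → unitInterval → X, IsConicalBicombing σ) →
      ∃ b : Wasserstein1 X → X, IsContractingBarycenterMap b) := by
  refine ⟨fun b hb => hb.isConicalBicombing, ?_⟩
  rintro _ ⟨σ, hσ⟩
  obtain ⟨β, hβ⟩ := hσ.isConicalMidpoint.exists_isMeanFamily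
  exact hβ.exists_contractingBarycenterMap
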